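/- **Definitions.** The *floats* $\mathbb F$ are the rationals whose reduced denominator is a power of $2$, with exact addition and multiplication. The float $\pm p/q$ in lowest terms is encoded by a sign bit followed by the binary expansions of $p$ and $q$, zero-padded to a common length and interleaved; its size is the length of this string, and the size of a tuple of floats is the sum of the sizes. Division by a positive integer $p$ is multiplication by the float $p^{-1} := \lfloor 2^{|p|}/p\rfloor / 2^{|p|}$, where $|p|$ is one more than the number of binary digits of $p$. The size of a pair in $\Sigma\times\mathbb N$ is $\lceil\log_2|\Sigma|\rceil$ plus the number of binary digits of the integer. A function $f$ is *size-preserving* if there are $c, N$ with $|f(x)| \le c\,|x|$ whenever $|x|\ge N$. An attention function maps scores $a\in\mathbb F^n$ (for every $n$) to weights in $\mathbb F^n$. Let $\mathcal M(a)$ be the set of positions of maximal score. *Hard* attention puts weight $1$ on $\min \mathcal M(a)$ and $0$ elsewhere; *(strong) saturated* attention puts weight $1/|\mathcal M(a)|$ on each position in $\mathcal M(a)$ and $0$ elsewhere; *uniform* attention puts weight $1/n$ on every position (divisions are float divisions). A *transformer* over $\mathbb F$ with finite alphabet $\Sigma$, dimension $k$, $L$ layers and $H$ heads per layer consists of a size-preserving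 embedding $\phi:\Sigma\times\mathbb N\to\mathbb F^k$, scoring functions $s_{\ell,h}:\mathbb F^k\times\mathbb F^k\to\mathbb F$, an attention function $\alpha_{\ell,h}$ for each head, and size-preserving activation functions $f_\ell:\mathbb F^k\times(\mathbb F^k)^H\to\mathbb F^k$. On $w=w_1\cdots w_n$ it computes $v_{0,i}=\phi(w_i,i)$ and, for $0 \le \ell < L$, $$b_{\ell+1,h,i}=\sum_{j=1}^n \alpha_{\ell+1,h}\big(s_{\ell+1,h}(v_{\ell,i},v_{\ell,1}),\dots,s_{\ell+1,h}(v_{\ell,i},v_{\ell,n})\big)_j\, v_{\ell,j},\qquad v_{\ell+1,i}=f_{\ell+1}(v_{\ell,i},b_{\ell+1,1,i},\dots,b_{\ell+1,H,i}).$$ It *recognizes* a language $\mathcal L\subseteq\Sigma^*$ if there are $W\in\mathbb Q^k$, $b\in\mathbb Q$ such that for all nonempty $w\in\Sigma^*$, $W\cdot v_{L,1}(w)+b>0 \iff w\in \mathcal L$. It is *saturated* if every head uses strong saturated attention, and *weak saturated* if every head uses either hard or uniform attention. Let $T_s(\mathbb F)$ and $T_{ws}(\mathbb F)$ be the classes of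 languages over $\{0,1\}$ recognized by saturated, respectively weak saturated, transformers over $\mathbb F$ (of any $k,L,H$). $\mathsf{AC}^0$ is the class of languages over $\{0,1\}$ recognized by a (nonuniform) family of circuits $(C_n)_{n\in\mathbb N}$, where $C_n$ is a circuit with $n$ inputs, leaves labelled by input bits and their negations, and $\wedge,\vee$ gates of unbounded fan-in; the size (number of gates) of $C_n$ is bounded by a polynomial in $n$ and its depth is bounded by a constant. **Proposition.** Let $\mathrm{MAJ}=\{w\in\{0,1\}^* : \#_1(w)>\#_0(w)\}$, where $\#_\sigma(w)$ is the number of occurrences of $\sigma$ in $w$. 1. There is a weak saturated transformer over $\mathbb F$ with one layer and one head, which uses uniform attention, that recognizes $\mathrm{MAJ}$. 2. $\mathrm{MAJ}\notin\mathsf{AC}^0$. 3. Consequently $T_{ws}(\mathbb F)\not\subseteq\mathsf{AC}^0$ and $T_s(\mathbb F)\not\subseteq\mathsf{AC}^0$. -/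

import Mathlib

namespace FloatTransformer

noncomputable section

/-! ### Floats -/

/-- The floats: rationals whose (reduced) denominator is a power of two, with the exact rational
addition and multiplication. -/
def floats : Subring ℚ where
  carrier := {x | ∃ e : ℕ, x.den = 2 ^ e}
  zero_mem' := ⟨0, rfl⟩
  one_mem' := ⟨0, rfl⟩
  add_mem' := by
    rintro x y ⟨a, ha⟩ ⟨b, hb⟩
    have h := Rat.add_den_dvd x y
    rw [ha, hb, ← pow_add] at h
    obtain ⟨e, -, he⟩ := (Nat.dvd_prime_pow Nat.prime_two).1 h
    exact ⟨e, he⟩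
  mul_mem' := by
    rintro x y ⟨a, ha⟩ ⟨b, hb⟩
    have h := Rat.mul_den_dvd x y
    rw [ha, hb, ← pow_add] at h
    obtain ⟨e, -, he⟩ := (Nat.dvd_prime_pow Nat.prime_two).1 h
    exact ⟨e, he⟩
  neg_mem' := by
    rintro x ⟨a, ha⟩
    exact ⟨a, by simpa using ha⟩

/-- The type of floats. -/
abbrev Flt : Type := floats

/-- The binary string of a float `± p / q` in lowest terms: a sign bit (`true` for nonnegative),
followed by the binary expansions of `p` and `q` (least significant bit first), padded with
zeros to a common length and interleaved. -/
def Flt.code (x : Flt) : List Bool :=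
  let p := Nat.bits (x : ℚ).num.natAbs
  let q := Nat.bits (x : ℚ).den
  let m := max p.length q.length
  decide (0 ≤ (x : ℚ)) ::
    (List.zipWith (fun a b => [a, b]) (p.rightpad m false) (q.rightpad m false)).flatten

/-- The size of a float, in bits. -/
def Flt.size (x : Flt) : ℕ := x.code.length

/-- The float `1 / 2`. -/
def Flt.half : Flt := ⟨1 / 2, 1, by norm_num⟩

/-- The size of a (nonnegative) integer: one sign bit and the binary digits of its magnitude. -/
def intSize (p : ℕ) : ℕ := 1 + Nat.size p

/-- The approximate float inverse of a positive integer `p`: numerator `⌊2 ^ |p| / p⌋` and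
denominator `2 ^ |p|`, where `|p|` is the size of `p`. -/
def Flt.approxInv (p : ℕ) : Flt := ((2 ^ intSize p / p : ℕ) : Flt) * Flt.half ^ intSize p

/-- Float division by a positive integer: multiplication by the approximate inverse. -/
def Flt.divInt (x : Flt) (p : ℕ) : Flt := x * Flt.approxInv p

/-- Vectors of floats. -/
abbrev Vec (k : ℕ) : Type := Fin k → Flt

/-- The size of a vector of floats, in bits. -/
def Vec.size {k : ℕ} (v : Vec k) : ℕ := ∑ i, (v i).size

/-! ### Size preservation -/

/-- `f` is size-preserving, for the given size functions on its domain and codomain. -/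
def SizePreserving {X Y : Type*} (sizeX : X → ℕ) (sizeY : Y → ℕ) (f : X → Y) : Prop :=
  ∃ c N : ℕ, ∀ x, N ≤ sizeX x → sizeY (f x) ≤ c * sizeX x

/-- The size, in bits, of a token together with its position. -/
def tokenPosSize {A : Type} [Fintype A] (x : A × ℕ) : ℕ :=
  Nat.clog 2 (Fintype.card A) + Nat.size x.2

/-- The size, in bits, of the input of an activation function: the previous value of the position
and the outputs of the `H` heads. -/
def activationInputSize {k H : ℕ} (x : Vec k × (Fin H → Vec k)) : ℕ :=
  x.1.size + ∑ h, (x.2 h).size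

/-! ### Attention functions -/

/-- An attention function maps a vector of `n` scores to `n` weights, for every `n`. -/
abbrev Attention : Type := (n : ℕ) → (Fin n → Flt) → Fin n → Flt

/-- The set of positions where the score is maximal. -/
def maximizers {n : ℕ} (a : Fin n → Flt) : Finset (Fin n) :=
  Finset.univ.filter fun i => ∀ j, a j ≤ a i

/-- Hard attention: all the weight is on the first position of maximal score. -/
def hardAttention : Attention := fun _ a j =>
  if j ∈ maximizers a ∧ ∀ m ∈ maximizers a, j ≤ m then 1 else 0

/-- (Strong) saturated attention: the weight is spread evenly over the positions of maximal
score. -/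
def saturatedAttention : Attention := fun _ a j =>
  Flt.divInt 1 (maximizers a).card * if j ∈ maximizers a then 1 else 0

/-- Uniform attention: every position has the weight `1 / n`. -/
def uniformAttention : Attention := fun n _ _ => Flt.divInt 1 n

/-! ### Transformers -/

/-- A transformer over floats with input alphabet `A` each of whose heads uses one of the attention
functions in `𝒜`, with size-preserving embedding and activation functions. -/
structure Transformer (A : Type) [Fintype A] (𝒜 : Set Attention) where
  /-- the model dimension -/
  dim : ℕ
  /-- the number of layers -/
  layers : ℕ
  /-- the number of heads per layer -/
  heads : ℕ
  /-- the embedding function -/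
  embed : A × ℕ → Vec dim
  embed_sizePreserving : SizePreserving tokenPosSize Vec.size embed
  /-- the attention function of each head -/
  attention : Fin layers → Fin heads → Attention
  attention_mem : ∀ l h, attention l h ∈ 𝒜
  /-- the scoring function of each head -/
  score : Fin layers → Fin heads → Vec dim → Vec dim → Flt
  /-- the activation function of each layer -/
  activation : Fin layers → Vec dim × (Fin heads → Vec dim) → Vec dim
  activation_sizePreserving :
    ∀ l, SizePreserving activationInputSize Vec.size (activation l)

namespace Transformer

variable {A : Type} [Fintype A] {𝒜 : Set Attention}

/-- The output, at position `i`, of head `h` of layer `l` on the value sequence `v`: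
the sum over `j` of the attention weight of `j` times `v j`. -/
def headOutput (T : Transformer A 𝒜) (l : Fin T.layers) (h : Fin T.heads) {n : ℕ}
    (v : Fin n → Vec T.dim) (i : Fin n) : Vec T.dim :=
  ∑ j, T.attention l h n (fun j' => T.score l h (v i) (v j')) j • v j

/-- The value sequence after `l` layers on the input string `w`. Positions are numbered from `1`
in the embedding. -/
def value (T : Transformer A 𝒜) (w : List A) :
    (l : ℕ) → l ≤ T.layers → Fin w.length → Vec T.dim
  | 0, _, i => T.embed (w.get i, i + 1)
  | l + 1, hl, i =>
      T.activation ⟨l, hl⟩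
        (T.value w l (Nat.le_of_succ_le hl) i,
          fun h => T.headOutput ⟨l, hl⟩ h (T.value w l (Nat.le_of_succ_le hl)) i)

/-- `T` recognizes `L` if a rational affine function of the first value of the last layer is
positive exactly on the strings in `L`. The empty string, which has no first position, is left
out. -/
def Recognizes (T : Transformer A 𝒜) (L : Language A) : Prop :=
  ∃ (W : Fin T.dim → ℚ) (b : ℚ), ∀ (w : List A) (hw : w ≠ []),
    0 < ∑ i, W i * (T.value w T.layers le_rfl ⟨0, List.length_pos_of_ne_nil hw⟩ i : ℚ) + b ↔
      w ∈ L

end Transformer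

/-- The languages recognized by float transformers whose heads use attention functions in `𝒜`. -/
def recognizable (A : Type) [Fintype A] (𝒜 : Set Attention) : Set (Language A) :=
  {L | ∃ T : Transformer A 𝒜, T.Recognizes L}

/-- Saturated attention: every head is (strongly) saturated. -/
def saturated : Set Attention := {saturatedAttention}

/-- Weak saturated attention: every head is either hard or uniform. -/
def weakSaturated : Set Attention := {hardAttention, uniformAttention}

/-! ### Circuits -/

/-- A literal: `(i, true)` is the `i`-th input bit and `(i, false)` is its negation. -/
abbrev Literal (n : ℕ) : Type := Fin n × Bool

/-- A Boolean circuit with `n` inputs and gates `∧`, `∨` of unbounded fan-in. It is an acyclic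
graph: the gates are numbered in a topological order, so the inputs of a gate are literals and
gates with a smaller number. -/
structure Circuit (n : ℕ) where
  /-- the number of gates -/
  size : ℕ
  /-- `true` for an `∧` gate, `false` for an `∨` gate -/
  isAnd : Fin size → Bool
  /-- the inputs of each gate -/
  inputs : (g : Fin size) → Finset (Literal n ⊕ Fin g)
  /-- the output node -/
  output : Literal n ⊕ Fin size

namespace Circuit

variable {n : ℕ}

/-- The truth value of a literal. -/
def litVal (x : Fin n → Bool) (u : Literal n) : Prop := x u.1 = u.2

/-- The truth value of a gate on the input `x`. -/
def gateVal (C : Circuit n) (x : Fin n → Bool) (g : Fin C.size) : Prop :=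
  if C.isAnd g then
    (∀ u : Literal n, Sum.inl u ∈ C.inputs g → litVal x u) ∧
      ∀ j : Fin g, Sum.inr j ∈ C.inputs g → C.gateVal x ⟨j, j.2.trans g.2⟩
  else
    (∃ u : Literal n, Sum.inl u ∈ C.inputs g ∧ litVal x u) ∨
      ∃ j : Fin g, Sum.inr j ∈ C.inputs g ∧ C.gateVal x ⟨j, j.2.trans g.2⟩
termination_by (g : ℕ)
decreasing_by all_goals exact j.2

/-- The circuit accepts `x`. -/
def Accepts (C : Circuit n) (x : Fin n → Bool) : Prop :=
  Sum.elim (litVal x) (C.gateVal x) C.output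

/-- The length of a longest path to a gate. -/
def gateDepth (C : Circuit n) (g : Fin C.size) : ℕ :=
  1 + (C.inputs g).sup (Sum.elim (fun _ => 0) fun j : Fin g => C.gateDepth ⟨j, j.2.trans g.2⟩)
termination_by (g : ℕ)
decreasing_by exact j.2

/-- The depth of a circuit: the length of a longest path to the output node. -/
def depth (C : Circuit n) : ℕ := Sum.elim (fun _ => 0) C.gateDepth C.output

end Circuit

/-- Nonuniform `AC⁰`: the languages recognized by a family of circuits of polynomial size and
bounded depth with `∧`, `∨` gates of unbounded fan-in. -/
def AC0 : Set (Language Bool) :=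
  {L | ∃ (C : (n : ℕ) → Circuit n) (p : Polynomial ℕ) (d : ℕ),
    (∀ n, (C n).size ≤ p.eval n) ∧ (∀ n, (C n).depth ≤ d) ∧
      ∀ w : List Bool, (C w.length).Accepts w.get ↔ w ∈ L}

/-- The majority language: the binary strings with more ones than zeros. -/
def MAJ : Language Bool := {w : List Bool | w.count true > w.count false}

end

end FloatTransformer

open FloatTransformer

namespace FloatTransformer

open Finset

/-! Membership: with all scores zero, uniform and saturated attention both give every position the
same weight, so averaging signs `±1` yields a multiple of `#₁ - #₀`. The truncated inverse only has
to be positive.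

Lower bound (Razborov–Smolensky, over `𝔽₂`): a circuit of size `s` and depth `d` agrees, off a
fraction `s / 2 ^ t` of the cube, with a polynomial of degree at most `t ^ d`
(`Circuit.exists_lowDegree_approx`). Conversely, if a polynomial of degree `D` equals majority of `2
* m + 1` bits on `G`, then every function on `G` has degree at most `m + D`, so `#G` is at most the
number of such monomials (`card_le_of_eq_majority`): half the cube plus `D` binomials of order `4 ^
m / √m`. Since `G` fills three quarters of the cube, `t ^ d` must be of order at least `√m`
(`le_of_computes_majority`), which fails for polynomial size when `m = 8 * t ^ (2 * d)` and `t` is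
large. -/

/-! ### Low-degree functions on the cube -/

/-- The monomial `∏ i ∈ S, x i`, as a function on the Boolean cube. -/
def monomial {n : ℕ} (S : Finset (Fin n)) (x : Fin n → Bool) : ZMod 2 :=
  ∏ i ∈ S, if x i then 1 else 0

/-- The functions on the Boolean cube given by polynomials over `𝔽₂` of degree at most `D`. -/
def lowDegree (n D : ℕ) : Submodule (ZMod 2) ((Fin n → Bool) → ZMod 2) :=
  Submodule.span _ (monomial '' {S | #S ≤ D})

variable {n : ℕ}

lemma monomial_eq_ite (S : Finset (Fin n)) (x : Fin n → Bool) :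
    monomial S x = if ∀ i ∈ S, x i then 1 else 0 := by
  unfold monomial
  split_ifs with h
  · exact prod_eq_one fun i hi => by simp [h i hi]
  · push Not at h
    obtain ⟨i, hi, hx⟩ := h
    exact prod_eq_zero hi (by simp [hx])

lemma monomial_mul_monomial (S T : Finset (Fin n)) :
    monomial S * monomial T = monomial (S ∪ T) := by
  ext x
  simp only [Pi.mul_apply, monomial_eq_ite, mem_union, or_imp, forall_and, ← ite_and, ite_mul,
    one_mul, zero_mul]

lemma monomial_mem {D : ℕ} {S : Finset (Fin n)} (h : #S ≤ D) : monomial S ∈ lowDegree n D :=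
  Submodule.subset_span ⟨S, h, rfl⟩

lemma lowDegree_mono {D E : ℕ} (h : D ≤ E) : lowDegree n D ≤ lowDegree n E :=
  Submodule.span_mono (Set.image_mono fun _ hS => le_trans hS h)

lemma one_mem_lowDegree (D : ℕ) : (1 : (Fin n → Bool) → ZMod 2) ∈ lowDegree n D := by
  convert monomial_mem (n := n) (D := D) (S := ∅) (by simp)
  ext x
  simp [monomial]

lemma mul_mem_lowDegree {D E : ℕ} {f g : (Fin n → Bool) → ZMod 2}
    (hf : f ∈ lowDegree n D) (hg : g ∈ lowDegree n E) : f * g ∈ lowDegree n (D + E) := by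
  have h : lowDegree n D * lowDegree n E ≤ lowDegree n (D + E) := by
    unfold lowDegree
    rw [Submodule.span_mul_span, Submodule.span_le]
    rintro _ ⟨_, ⟨S, hS, rfl⟩, _, ⟨T, hT, rfl⟩, rfl⟩
    simp only [monomial_mul_monomial]
    exact monomial_mem ((card_union_le _ _).trans (add_le_add hS hT))
  exact h (Submodule.mul_mem_mul hf hg)

lemma finrank_lowDegree_le (n D : ℕ) :
    Module.finrank (ZMod 2) (lowDegree n D) ≤ ∑ i ∈ range (D + 1), n.choose i := by
  classical
  have h : monomial '' {S : Finset (Fin n) | #S ≤ D} =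
      ↑(((range (D + 1)).biUnion fun i => powersetCard i univ).image (monomial (n := n))) := by
    ext f
    simp
  rw [lowDegree, h]
  refine (finrank_span_finset_le_card _).trans (card_image_le.trans (card_biUnion_le.trans ?_))
  simp

/-- The coordinate function `x ↦ x i` and its negation have degree at most one. -/
lemma literal_mem_lowDegree (i : Fin n) (b : Bool) :
    (fun x : Fin n → Bool => if x i = b then (1 : ZMod 2) else 0) ∈ lowDegree n 1 := by
  have h := monomial_mem (n := n) (D := 1) (S := {i}) (by simp)
  cases b
  · convert sub_mem (one_mem_lowDegree 1) h using 1
    ext x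
    cases hx : x i <;> simp [monomial, hx]
  · convert h using 1
    ext x
    simp [monomial]

/-- Substituting `1 - x i` for `x i` does not raise the degree. This carries facts about light
inputs over to heavy ones. -/
lemma comp_not_mem_lowDegree {D : ℕ} {f : (Fin n → Bool) → ZMod 2} (hf : f ∈ lowDegree n D) :
    (fun x => f fun i => !x i) ∈ lowDegree n D := by
  have h : lowDegree n D ≤ (lowDegree n D).comap
      (LinearMap.funLeft (ZMod 2) (ZMod 2) fun (x : Fin n → Bool) i => !x i) := by
    conv_lhs => rw [lowDegree]
    rw [Submodule.span_le]
    rintro _ ⟨S, hS, rfl⟩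
    suffices h : ∀ S : Finset (Fin n), (fun x => monomial S fun i => !x i) ∈ lowDegree n #S from
      lowDegree_mono hS (h S)
    intro S
    induction S using Finset.induction_on with
    | empty => exact one_mem_lowDegree 0
    | insert a S ha ih =>
      rw [card_insert_of_notMem ha, add_comm]
      convert mul_mem_lowDegree (literal_mem_lowDegree a false) ih using 1
      ext x
      simp [monomial, prod_insert ha]
  exact h hf

/-- Functions on the Hamming ball of radius `k` have degree at most `k`. -/
lemma exists_lowDegree_eq_of_card_le (f : (Fin n → Bool) → ZMod 2) (k : ℕ) :
    ∃ g ∈ lowDegree n k, ∀ x, #{i | x i = true} ≤ k → g x = f x := by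
  induction k with
  | zero =>
    refine ⟨f (fun _ => false) • 1, Submodule.smul_mem _ _ (one_mem_lowDegree 0), fun x hx => ?_⟩
    have : x = fun _ => false := by
      ext i
      simp only [Nat.le_zero, card_eq_zero, filter_eq_empty_iff, mem_univ, true_imp_iff] at hx
      simpa using @hx i
    simp [this]
  | succ k ih =>
    obtain ⟨g, hg, h⟩ := ih
    -- On inputs of weight at most `k + 1`, a monomial of size `k + 1` is nonzero only at the
    -- indicator of its own set, so the values on the new layer can be corrected independently.
    refine ⟨g + ∑ S ∈ powersetCard (k + 1) univ,
      (f (fun i => decide (i ∈ S)) - g fun i => decide (i ∈ S)) • monomial S,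
      add_mem (lowDegree_mono k.le_succ hg) (sum_mem fun S hS => Submodule.smul_mem _ _
        (monomial_mem (mem_powersetCard.1 hS).2.le)), fun x hx => ?_⟩
    have key : ∀ S : Finset (Fin n), #S = k + 1 → S ≠ ({i | x i = true} : Finset _) →
        monomial S x = 0 := by
      intro S hS hne
      rw [monomial_eq_ite, if_neg]
      intro hall
      exact hne (eq_of_subset_of_card_le (fun i hi => by simpa using hall i hi) (by omega))
    simp only [Pi.add_apply, Finset.sum_apply, Pi.smul_apply, smul_eq_mul]
    rcases hx.lt_or_eq with hlt | heq
    · rw [sum_eq_zero, add_zero, h x (by omega)]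
      intro S hS
      have hS := (mem_powersetCard.1 hS).2
      rw [key S hS (by rintro rfl; omega), mul_zero]
    · rw [sum_eq_single ({i | x i = true} : Finset _)]
      · simp [monomial_eq_ite]
      · intro S hS hne
        rw [key S (mem_powersetCard.1 hS).2 hne, mul_zero]
      · intro hn
        simp [heq] at hn

/-- A function of degree `D` agrees with the majority function on a set no larger than the number
of monomials of degree at most `m + D`. -/
lemma card_le_of_eq_majority {m D : ℕ} {q : (Fin (2 * m + 1) → Bool) → ZMod 2}
    (hq : q ∈ lowDegree (2 * m + 1) D) (G : Finset (Fin (2 * m + 1) → Bool))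
    (hG : ∀ x ∈ G, q x = if m < #{i | x i = true} then 1 else 0) :
    #G ≤ ∑ i ∈ range (m + D + 1), (2 * m + 1).choose i := by
  refine le_trans ?_ (finrank_lowDegree_le _ _)
  let R := LinearMap.funLeft (ZMod 2) (ZMod 2) (Subtype.val : G → Fin (2 * m + 1) → Bool)
  -- Surjectivity of restriction to `G` bounds `#G` by the dimension of the source.
  have hR : (lowDegree (2 * m + 1) (m + D)).map R = ⊤ := by
    rw [eq_top_iff]
    rintro f -
    obtain ⟨F, rfl⟩ := LinearMap.funLeft_surjective_of_injective (ZMod 2) (ZMod 2) _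
      (Subtype.val_injective : Function.Injective (Subtype.val : G → Fin (2 * m + 1) → Bool)) f
    obtain ⟨g, hg, hgF⟩ := exists_lowDegree_eq_of_card_le F m
    obtain ⟨h, hh, hhF⟩ := exists_lowDegree_eq_of_card_le (fun x => F fun i => !x i) m
    -- On `G`, `q` selects the half of the cube: `g` is right at weight at most `m`, and `h` after
    -- negation at weight above `m`.
    refine ⟨(1 - q) * g + q * fun x => h fun i => !x i, add_mem ?_ ?_, ?_⟩
    · rw [add_comm m]
      exact mul_mem_lowDegree (sub_mem (one_mem_lowDegree D) hq) hg
    · rw [add_comm m]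
      exact mul_mem_lowDegree hq (comp_not_mem_lowDegree hh)
    · ext ⟨x, hx⟩
      simp only [R, LinearMap.funLeft_apply, Pi.add_apply, Pi.mul_apply, Pi.sub_apply, hG x hx,
        Pi.one_apply]
      split_ifs with hm
      · have hc := card_filter_add_card_filter_not (s := univ) fun i => x i = true
        simp only [card_univ, Fintype.card_fin] at hc
        simp only [sub_self, zero_mul, zero_add, one_mul]
        rw [hhF _ (by simp only [Bool.not_eq_true', Bool.not_eq_true] at hc ⊢; omega)]
        simp
      · simp [hgF x (by omega)]
  have := Submodule.finrank_map_le R (lowDegree (2 * m + 1) (m + D))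
  rw [hR] at this
  simpa using this

/-! ### Approximation of gates -/

/-- Some subset sum is odd on at least half of a set of nonzero vectors over `𝔽₂`. -/
lemma exists_subset_sum_zero_card_le {X ι : Type*} (I : Finset ι) (y : ι → X → ZMod 2)
    (B : Finset X) (hB : ∀ x ∈ B, ∃ i ∈ I, y i x = 1) :
    ∃ S ⊆ I, 2 * #{x ∈ B | ∑ i ∈ S, y i x = 0} ≤ #B := by
  classical
  have hx : ∀ x ∈ B, ∑ S ∈ I.powerset, 2 * (if ∑ i ∈ S, y i x = 0 then 1 else 0) =
      ∑ S ∈ I.powerset, 1 := by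
    intro x hx
    obtain ⟨a, ha, hy⟩ := hB x hx
    -- Pair `S` with `insert a S`: as `y a x = 1`, exactly one of the two sums vanishes. Averaging
    -- over `S` then gives a good subset.
    rw [← insert_erase ha, sum_powerset_insert (notMem_erase a I),
      sum_powerset_insert (notMem_erase a I), ← sum_add_distrib, ← sum_add_distrib]
    refine sum_congr rfl fun S hS => ?_
    rw [sum_insert fun h => notMem_erase a I (mem_powerset.1 hS h), hy]
    generalize ∑ i ∈ S, y i x = z
    revert z
    decide
  obtain ⟨S, hS, h⟩ := exists_le_of_sum_le (s := I.powerset)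
    (f := fun S => 2 * #{x ∈ B | ∑ i ∈ S, y i x = 0}) (g := fun _ => #B)
    (powerset_nonempty I) (by
      simp only [card_filter, mul_sum]
      rw [sum_comm, sum_congr rfl hx, sum_comm]
      simp)
  exact ⟨S, mem_powerset.1 hS, h⟩

/-- Each of `t` subset sums halves the set of undetected inputs. `E` is chosen from the true values
`y` before the approximations `q`, so the errors of different gates merely add up. -/
lemma exists_lowDegree_approx {ι : Type*} (I : Finset ι) (y : ι → (Fin n → Bool) → ZMod 2)
    (B : Finset (Fin n → Bool)) (hB : ∀ x ∈ B, ∃ i ∈ I, y i x = 1) (t : ℕ) :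
    ∃ E ⊆ B, #E * 2 ^ t ≤ #B ∧ ∀ D, ∀ q : ι → (Fin n → Bool) → ZMod 2,
      (∀ i ∈ I, q i ∈ lowDegree n D) → ∃ r ∈ lowDegree n (t * D), ∀ x, (∀ i ∈ I, q i x = y i x) →
        (x ∈ B → x ∉ E → r x = 1) ∧ ((∀ i ∈ I, y i x = 0) → r x = 0) := by
  induction t with
  | zero =>
    exact ⟨B, subset_rfl, by simp, fun D q _ => ⟨0, zero_mem _, fun x _ =>
      ⟨fun h h' => absurd h h', fun _ => rfl⟩⟩⟩
  | succ t ih =>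
    obtain ⟨E, hEB, hE, h⟩ := ih
    obtain ⟨S, hS, hcard⟩ := exists_subset_sum_zero_card_le I y E fun x hx => hB x (hEB hx)
    refine ⟨{x ∈ E | ∑ i ∈ S, y i x = 0}, (filter_subset _ _).trans hEB, ?_, fun D q hq => ?_⟩
    · calc _ = 2 * #{x ∈ E | ∑ i ∈ S, y i x = 0} * 2 ^ t := by ring
        _ ≤ #E * 2 ^ t := by gcongr
        _ ≤ #B := hE
    obtain ⟨r, hr, hrx⟩ := h D q hq
    have hs : ∑ i ∈ S, q i ∈ lowDegree n D := sum_mem fun i hi => hq i (hS hi)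
    have h1 : t * D ≤ (t + 1) * D := by gcongr; omega
    have h2 : D ≤ (t + 1) * D := Nat.le_mul_of_pos_left _ t.succ_pos
    -- The polynomial `r + s - r * s` is the disjunction of `r` and `s` on values in `𝔽₂`.
    refine ⟨r + ∑ i ∈ S, q i - r * ∑ i ∈ S, q i, sub_mem (add_mem (lowDegree_mono h1 hr)
      (lowDegree_mono h2 hs)) (by
        rw [add_one_mul]; exact mul_mem_lowDegree hr hs), fun x hx => ?_⟩
    have hsx : (∑ i ∈ S, q i) x = ∑ i ∈ S, y i x := by
      rw [Finset.sum_apply]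
      exact sum_congr rfl fun i hi => hx i (hS hi)
    simp only [Pi.sub_apply, Pi.add_apply, Pi.mul_apply, hsx]
    refine ⟨fun hxB hxE => ?_, fun h0 => ?_⟩
    · by_cases hxE' : x ∈ E
      · have h01 : ∀ z : ZMod 2, z ≠ 0 → z = 1 := by decide
        rw [h01 _ fun h0 => hxE (mem_filter.2 ⟨hxE', h0⟩)]
        ring
      · rw [(hrx x hx).1 hxB hxE']
        ring
    · rw [(hrx x hx).2 h0, sum_eq_zero fun i hi => h0 i (hS hi)]
      ring

open Classical in
/-- The indicator, in `𝔽₂`, of a proposition. -/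
noncomputable def indicator (p : Prop) : ZMod 2 := if p then 1 else 0

lemma indicator_of_true {p : Prop} (h : p) : indicator p = 1 := if_pos h

lemma indicator_of_false {p : Prop} (h : ¬p) : indicator p = 0 := if_neg h

lemma indicator_not (p : Prop) : indicator (¬p) = 1 - indicator p := by
  by_cases h : p <;> simp [indicator, h]

/-- Razborov's approximation of a disjunction. -/
lemma exists_lowDegree_approx_or {ι : Type*} (I : Finset ι) (y : ι → (Fin n → Bool) → Prop)
    (t : ℕ) :
    ∃ E : Finset (Fin n → Bool), #E * 2 ^ t ≤ 2 ^ n ∧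
      ∀ D, ∀ q : ι → (Fin n → Bool) → ZMod 2, (∀ i ∈ I, q i ∈ lowDegree n D) →
        ∃ r ∈ lowDegree n (t * D), ∀ x, (∀ i ∈ I, q i x = indicator (y i x)) → x ∉ E →
          r x = indicator (∃ i ∈ I, y i x) := by
  classical
  obtain ⟨E, -, hE, h⟩ := exists_lowDegree_approx I (fun i x => indicator (y i x))
    {x | ∃ i ∈ I, y i x} (fun x hx => by
      obtain ⟨i, hi, hy⟩ := (mem_filter.1 hx).2
      exact ⟨i, hi, indicator_of_true hy⟩) t
  refine ⟨E, hE.trans ((card_le_univ _).trans (by simp)), fun D q hq => ?_⟩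
  obtain ⟨r, hr, hrx⟩ := h D q hq
  refine ⟨r, hr, fun x hx hxE => ?_⟩
  by_cases hy : ∃ i ∈ I, y i x
  · rw [indicator_of_true hy, (hrx x hx).1 (by simpa using hy) hxE]
  · rw [indicator_of_false hy, (hrx x hx).2 fun i hi => indicator_of_false fun h => hy ⟨i, hi, h⟩]

/-- De Morgan: `z ↦ 1 - z` preserves the degree bound. -/
lemma exists_lowDegree_approx_and {ι : Type*} (I : Finset ι) (y : ι → (Fin n → Bool) → Prop)
    (t : ℕ) :
    ∃ E : Finset (Fin n → Bool), #E * 2 ^ t ≤ 2 ^ n ∧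
      ∀ D, ∀ q : ι → (Fin n → Bool) → ZMod 2, (∀ i ∈ I, q i ∈ lowDegree n D) →
        ∃ r ∈ lowDegree n (t * D), ∀ x, (∀ i ∈ I, q i x = indicator (y i x)) → x ∉ E →
          r x = indicator (∀ i ∈ I, y i x) := by
  obtain ⟨E, hE, h⟩ := exists_lowDegree_approx_or I (fun i x => ¬y i x) t
  refine ⟨E, hE, fun D q hq => ?_⟩
  obtain ⟨r, hr, hrx⟩ := h D (fun i => 1 - q i) fun i hi => sub_mem (one_mem_lowDegree D) (hq i hi)
  refine ⟨1 - r, sub_mem (one_mem_lowDegree _) hr, fun x hx hxE => ?_⟩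
  have := hrx x (fun i hi => by simp [hx i hi, indicator_not]) hxE
  rw [Pi.sub_apply, this, Pi.one_apply, ← indicator_not]
  congr 1
  simp

/-! ### Approximation of circuits -/

namespace Circuit

/-- The truth value of an input of the gate `g`. -/
def inputVal (C : Circuit n) (g : Fin C.size) (u : Literal n ⊕ Fin g) (x : Fin n → Bool) : Prop :=
  Sum.elim (litVal x) (fun j : Fin g => C.gateVal x ⟨j, j.2.trans g.2⟩) u

lemma gateVal_and (C : Circuit n) {g : Fin C.size} (hg : C.isAnd g = true) (x : Fin n → Bool) :
    C.gateVal x g ↔ ∀ u ∈ C.inputs g, C.inputVal g u x := by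
  rw [gateVal, if_pos hg]
  simp [inputVal, Sum.forall]

lemma gateVal_or (C : Circuit n) {g : Fin C.size} (hg : ¬C.isAnd g = true) (x : Fin n → Bool) :
    C.gateVal x g ↔ ∃ u ∈ C.inputs g, C.inputVal g u x := by
  rw [gateVal, if_neg hg]
  simp [inputVal, Sum.exists]

lemma litVal_mem_lowDegree (u : Literal n) :
    (fun x => indicator (litVal x u)) ∈ lowDegree n 1 := by
  convert literal_mem_lowDegree u.1 u.2
  unfold indicator litVal
  congr

lemma exists_gate_approx (C : Circuit n) (g : Fin C.size) (t : ℕ) :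
    ∃ E : Finset (Fin n → Bool), #E * 2 ^ t ≤ 2 ^ n ∧
      ∀ D, ∀ q : Literal n ⊕ Fin g → (Fin n → Bool) → ZMod 2,
        (∀ u ∈ C.inputs g, q u ∈ lowDegree n D) →
        ∃ r ∈ lowDegree n (t * D), ∀ x,
          (∀ u ∈ C.inputs g, q u x = indicator (C.inputVal g u x)) → x ∉ E →
            r x = indicator (C.gateVal x g) := by
  by_cases hg : C.isAnd g = true
  · simp only [C.gateVal_and hg]
    exact exists_lowDegree_approx_and _ _ t
  · simp only [C.gateVal_or hg]
    exact exists_lowDegree_approx_or _ _ t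

/-- A circuit agrees with a function of degree `t ^ depth`, but for a fraction `size / 2 ^ t` of
the inputs. -/
lemma exists_lowDegree_approx (C : Circuit n) {t : ℕ} (ht : 0 < t) :
    ∃ E : Finset (Fin n → Bool), #E * 2 ^ t ≤ C.size * 2 ^ n ∧
      ∃ r ∈ lowDegree n (t ^ C.depth), ∀ x ∉ E, r x = indicator (C.Accepts x) := by
  classical
  choose E hE h using fun g => C.exists_gate_approx g t
  -- Off the union of the error sets every gate is computed exactly, and each level multiplies the
  -- degree by `t`.
  have key : ∀ k, ∀ hk : k < C.size, ∃ r ∈ lowDegree n (t ^ C.gateDepth ⟨k, hk⟩),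
      ∀ x ∉ univ.biUnion E, r x = indicator (C.gateVal x ⟨k, hk⟩) := by
    intro k
    induction k using Nat.strong_induction_on with
    | _ k ih =>
    intro hk
    choose q hq hqx using fun j : Fin k => ih j j.2 (j.2.trans hk)
    obtain ⟨r, hr, hrx⟩ := h ⟨k, hk⟩ (t ^ (C.inputs ⟨k, hk⟩).sup (Sum.elim (fun _ => 0)
      fun j : Fin k => C.gateDepth ⟨j, j.2.trans hk⟩))
      (Sum.elim (fun u x => indicator (litVal x u)) q) (by
        intro u hu
        have hle := le_sup (f := Sum.elim (fun _ => 0)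
          fun j : Fin k => C.gateDepth ⟨j, j.2.trans hk⟩) hu
        refine lowDegree_mono (Nat.pow_le_pow_right ht hle) ?_
        rcases u with u | j
        · exact litVal_mem_lowDegree u
        · exact hq j)
    rw [gateDepth, pow_add, pow_one]
    refine ⟨r, hr, fun x hx => hrx x ?_ fun hxE => hx (mem_biUnion.2 ⟨_, mem_univ _, hxE⟩)⟩
    rintro (u | j) -
    · rfl
    · exact hqx j x hx
  refine ⟨univ.biUnion E, ?_, ?_⟩
  · calc #(univ.biUnion E) * 2 ^ t ≤ (∑ g, #(E g)) * 2 ^ t := by gcongr; exact card_biUnion_le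
      _ = ∑ g, #(E g) * 2 ^ t := sum_mul _ _ _
      _ ≤ ∑ _g : Fin C.size, 2 ^ n := sum_le_sum fun g _ => hE g
      _ = C.size * 2 ^ n := by simp
  · unfold depth Accepts
    rcases C.output with u | g
    · exact ⟨_, litVal_mem_lowDegree u, fun x _ => rfl⟩
    · exact key g g.2

end Circuit

/-! ### Majority needs large circuits -/

/-- The induction step rests on `(2 * m + 1) * (2 * m + 3) ≤ (2 * m + 2) ^ 2`. -/
lemma centralBinom_sq_mul_le (m : ℕ) : m.centralBinom ^ 2 * (2 * m + 1) ≤ 16 ^ m := by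
  induction m with
  | zero => simp
  | succ m ih =>
    have h := Nat.succ_mul_centralBinom_succ m
    refine le_of_mul_le_mul_left ?_ (by positivity : 0 < (m + 1) ^ 2)
    calc (m + 1) ^ 2 * ((m + 1).centralBinom ^ 2 * (2 * (m + 1) + 1))
        = ((m + 1) * (m + 1).centralBinom) ^ 2 * (2 * m + 3) := by ring
      _ = 4 * (m.centralBinom ^ 2 * (2 * m + 1)) * ((2 * m + 1) * (2 * m + 3)) := by rw [h]; ring
      _ ≤ 4 * 16 ^ m * (4 * (m + 1) ^ 2) :=
        Nat.mul_le_mul (Nat.mul_le_mul_left 4 ih) (by nlinarith)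
      _ = (m + 1) ^ 2 * 16 ^ (m + 1) := by ring

/-- The first `m + 1` binomials sum to exactly `4 ^ m`; each of the other `D` is at most the middle
one, which is half of `(m + 1).centralBinom`. -/
lemma sum_range_choose_le (m D : ℕ) :
    2 * ∑ i ∈ range (m + D + 1), (2 * m + 1).choose i ≤
      2 * 4 ^ m + D * (m + 1).centralBinom := by
  have h1 : ∀ i, 2 * (2 * m + 1).choose i ≤ (m + 1).centralBinom := by
    intro i
    have h2 := Nat.choose_le_middle i (2 * m + 1)
    have h3 : (m + 1).centralBinom = 2 * (2 * m + 1).choose m := by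
      rw [Nat.centralBinom, show 2 * (m + 1) = (2 * m + 1) + 1 by ring, Nat.choose_succ_succ,
        Nat.choose_symm_half]
      ring
    rw [show (2 * m + 1) / 2 = m by omega] at h2
    omega
  rw [show m + D + 1 = m + 1 + D by ring, sum_range_add, Nat.sum_range_choose_halfway, mul_add,
    mul_sum]
  gcongr
  exact (sum_le_sum fun i _ => h1 (m + 1 + i)).trans (by simp)

/-- A lower bound for circuits that compute the majority of an odd number of bits. -/
lemma le_of_computes_majority {m t d : ℕ} (ht : 0 < t) (C : Circuit (2 * m + 1))
    (hd : C.depth ≤ d) (hs : 4 * C.size ≤ 2 ^ t)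
    (hC : ∀ x, C.Accepts x ↔ m < #{i | x i = true}) :
    2 * m + 3 ≤ 16 * t ^ (2 * d) := by
  obtain ⟨E, hE, r, hr, hrx⟩ := C.exists_lowDegree_approx ht
  have hG := card_le_of_eq_majority (lowDegree_mono (Nat.pow_le_pow_right ht hd) hr) Eᶜ
    fun x hx => by
      rw [hrx x (mem_compl.1 hx), indicator]
      simp only [hC]
  have hE4 : 4 * #E ≤ 2 ^ (2 * m + 1) := by
    refine le_of_mul_le_mul_right ?_ (by positivity : 0 < 2 ^ t)
    calc 4 * #E * 2 ^ t = 4 * (#E * 2 ^ t) := by ring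
      _ ≤ 4 * (C.size * 2 ^ (2 * m + 1)) := by gcongr
      _ = 4 * C.size * 2 ^ (2 * m + 1) := by ring
      _ ≤ 2 ^ t * 2 ^ (2 * m + 1) := by gcongr
      _ = _ := mul_comm _ _
  have hcard := card_add_card_compl E
  simp only [Fintype.card_fun, Fintype.card_fin, Fintype.card_bool] at hcard
  have hsum := sum_range_choose_le m (t ^ d)
  have h4 : 2 ^ (2 * m + 1) = 2 * 4 ^ m := by rw [pow_succ, pow_mul]; ring
  -- The complement of `E` has at least `3 / 4 * (2 * 4 ^ m)` points, of which the lower half of the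
  -- binomials accounts for only `4 ^ m`.
  have hmain : 4 ^ m ≤ t ^ d * (m + 1).centralBinom := by omega
  refine le_of_mul_le_mul_left ?_ (by positivity : 0 < 16 ^ m)
  calc 16 ^ m * (2 * m + 3) = (4 ^ m) ^ 2 * (2 * m + 3) := by
        rw [← pow_mul, mul_comm m, pow_mul]; norm_num
    _ ≤ (t ^ d * (m + 1).centralBinom) ^ 2 * (2 * m + 3) := by gcongr
    _ = t ^ (2 * d) * ((m + 1).centralBinom ^ 2 * (2 * (m + 1) + 1)) := by ring
    _ ≤ t ^ (2 * d) * 16 ^ (m + 1) := by gcongr; exact centralBinom_sq_mul_le _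
    _ = 16 ^ m * (16 * t ^ (2 * d)) := by ring

open Filter Asymptotics in
lemma eventually_polynomial_eval_le_two_pow (p : Polynomial ℕ) :
    ∀ᶠ t : ℕ in atTop, p.eval t ≤ 2 ^ t := by
  have h : (fun t : ℕ => ((p.eval t : ℕ) : ℝ)) =o[atTop] fun t : ℕ => (2 : ℝ) ^ t := by
    induction p using Polynomial.induction_on' with
    | add p q hp hq => simpa using hp.add hq
    | monomial k a =>
      simpa using (isLittleO_pow_const_const_pow_of_one_lt k (one_lt_two : (1 : ℝ) < 2)).const_mul_left
        (a : ℝ)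
  filter_upwards [h.bound one_pos] with t ht
  simp only [Real.norm_natCast, norm_pow, Real.norm_ofNat, one_mul] at ht
  exact_mod_cast ht

lemma mem_MAJ_iff (w : List Bool) : w ∈ MAJ ↔ w.count false < w.count true := Iff.rfl

lemma count_true_ofFn (x : Fin n → Bool) : (List.ofFn x).count true = #{i | x i = true} := by
  induction n with
  | zero => simp
  | succ n ih =>
    rw [List.ofFn_succ, List.count_cons, ih, Fin.card_filter_univ_succ]
    cases h : x 0 <;> simp [add_comm]

lemma ofFn_mem_MAJ_iff {m : ℕ} (x : Fin (2 * m + 1) → Bool) :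
    List.ofFn x ∈ MAJ ↔ m < #{i | x i = true} := by
  have h := List.count_true_add_count_false (List.ofFn x)
  rw [List.length_ofFn] at h
  rw [mem_MAJ_iff, ← count_true_ofFn]
  omega

theorem MAJ_notMem_AC0 : MAJ ∉ AC0 := by
  rintro ⟨C, p, d, hsize, hdepth, hC⟩
  have hC' : ∀ n (x : Fin n → Bool), (C n).Accepts x ↔ List.ofFn x ∈ MAJ := by
    intro n x
    rw [← hC]
    -- Replacing `⟨n, x⟩` by the length and entries of a list avoids a cast along `(List.ofFn
    -- x).length = n`.
    obtain ⟨w, hw⟩ := List.equivSigmaTuple.surjective ⟨n, x⟩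
    cases hw
    rw [show List.ofFn w.get = w from List.ofFn_get w]
  -- The input length is `2 * m + 1` with `m = 8 * t ^ (2 * d)`, just large enough to contradict `2
  -- * m + 3 ≤ 16 * t ^ (2 * d)`.
  let P : Polynomial ℕ := 4 * p.comp (16 * Polynomial.X ^ (2 * d) + 1)
  obtain ⟨t, hP, ht⟩ := ((eventually_polynomial_eval_le_two_pow P).and
    (Filter.eventually_gt_atTop 0)).exists
  have h := le_of_computes_majority (m := 8 * t ^ (2 * d)) ht (C _) (hdepth _)
    (by
      refine le_trans (Nat.mul_le_mul_left 4 (hsize _)) (le_trans (le_of_eq ?_) hP)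
      simp only [P, Polynomial.eval_mul, Polynomial.eval_comp, Polynomial.eval_add,
        Polynomial.eval_pow, Polynomial.eval_X, Polynomial.eval_one, Polynomial.eval_ofNat]
      congr 2
      push_cast
      ring)
    fun x => (hC' _ x).trans (ofFn_mem_MAJ_iff x)
  omega


/-! ### A transformer for majority -/

/-- This keeps the floor in `Flt.approxInv` from being zero. -/
lemma le_two_pow_intSize (n : ℕ) : n ≤ 2 ^ intSize n := by
  unfold intSize
  have := Nat.lt_size_self n
  rw [pow_add]
  omega

lemma Flt.approxInv_pos {n : ℕ} (hn : n ≠ 0) : (0 : ℚ) < (Flt.approxInv n : ℚ) := by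
  have h : 0 < 2 ^ intSize n / n := Nat.div_pos (le_two_pow_intSize n) (Nat.pos_of_ne_zero hn)
  simp only [approxInv, half, Subring.coe_mul, Subring.coe_natCast, SubmonoidClass.coe_pow]
  positivity

/-- The transformer that averages the signs of the input bits. -/
def signAverage {𝒜 : Set Attention} (α : Attention) (hα : α ∈ 𝒜) : Transformer Bool 𝒜 where
  dim := 1
  layers := 1
  heads := 1
  embed x := fun _ => if x.1 then 1 else -1
  embed_sizePreserving := by
    refine ⟨max (Flt.size 1) (Flt.size (-1)), 1, fun x hx => ?_⟩
    refine le_trans ?_ (Nat.le_mul_of_pos_right _ hx)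
    rcases x with ⟨_ | _, _⟩ <;> simp [Vec.size]
  attention _ _ := α
  attention_mem _ _ := hα
  score _ _ _ _ := 0
  activation _ x := x.2 0
  activation_sizePreserving _ := ⟨1, 0, fun x _ => by simp [activationInputSize]⟩

lemma sum_sign_eq (w : List Bool) :
    ∑ j : Fin w.length, (if w.get j then (1 : ℚ) else -1) = w.count true - w.count false := by
  induction w with
  | nil => simp
  | cons a w ih =>
    have : ∑ j : Fin (a :: w).length, (if (a :: w).get j then (1 : ℚ) else -1) =
        (if a then 1 else -1) + ∑ j : Fin w.length, (if w.get j then (1 : ℚ) else -1) :=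
      Fin.sum_univ_succ _
    rw [this, ih]
    cases a <;> simp <;> ring

lemma sum_smul_sign_eq (w : List Bool) (c : Fin w.length → Flt) (a : Flt) (hc : ∀ j, c j = a)
    (i : Fin 1) :
    (((∑ j : Fin w.length, c j • (fun _ => if w.get j then 1 else -1 : Vec 1)) i : Flt) : ℚ) =
      a * (w.count true - w.count false) := by
  rw [← sum_sign_eq, Finset.sum_apply, AddSubmonoidClass.coe_finsetSum, Finset.mul_sum]
  refine Finset.sum_congr rfl fun j _ => ?_
  rw [hc, Pi.smul_apply, smul_eq_mul, Subring.coe_mul]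
  split_ifs <;> rfl

lemma signAverage_recognizes {𝒜 : Set Attention} (α : Attention) (hα : α ∈ 𝒜)
    (h : ∀ n (j : Fin n), α n (fun _ => 0) j = Flt.approxInv n) :
    (signAverage α hα).Recognizes MAJ := by
  refine ⟨fun _ => 1, 0, fun w hw => ?_⟩
  have hval : ∀ i, ((signAverage α hα).value w (signAverage α hα).layers le_rfl
      ⟨0, List.length_pos_of_ne_nil hw⟩ i : ℚ) =
      (Flt.approxInv w.length : ℚ) * (w.count true - w.count false) :=
    fun i => sum_smul_sign_eq w _ _ (h w.length) i
  have hpos := Flt.approxInv_pos (List.length_pos_of_ne_nil hw).ne'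
  have hsum : ∑ i, (1 : ℚ) * ((signAverage α hα).value w (signAverage α hα).layers le_rfl
      ⟨0, List.length_pos_of_ne_nil hw⟩ i : ℚ) + 0 =
      (Flt.approxInv w.length : ℚ) * (w.count true - w.count false) := by
    rw [add_zero, Finset.sum_congr rfl fun i _ => (one_mul _).trans (hval i)]
    exact Fin.sum_univ_one _
  rw [hsum, mul_pos_iff_of_pos_left hpos, sub_pos, Nat.cast_lt]
  rfl

lemma uniformAttention_eq (n : ℕ) (a : Fin n → Flt) (j : Fin n) :
    uniformAttention n a j = Flt.approxInv n :=
  one_mul _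

lemma saturatedAttention_const (n : ℕ) (a : Flt) (j : Fin n) :
    saturatedAttention n (fun _ => a) j = Flt.approxInv n := by
  simp [saturatedAttention, maximizers, Flt.divInt]

end FloatTransformer

open FloatTransformer
theorem mainTheorem2 :
    (∃ T : Transformer Bool weakSaturated,
      T.layers = 1 ∧ T.heads = 1 ∧ (∀ l h, T.attention l h = uniformAttention) ∧
        T.Recognizes MAJ) ∧
    MAJ ∉ AC0 ∧
    ¬ recognizable Bool weakSaturated ⊆ AC0 ∧
    ¬ recognizable Bool saturated ⊆ AC0 := by
  have hws : uniformAttention ∈ weakSaturated := Or.inr rfl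
  have hs : saturatedAttention ∈ saturated := rfl
  have hrec := signAverage_recognizes uniformAttention hws fun n j => uniformAttention_eq n _ j
  exact ⟨⟨_, rfl, rfl, fun _ _ => rfl, hrec⟩, MAJ_notMem_AC0,
    fun h => MAJ_notMem_AC0 (h ⟨_, hrec⟩),
    fun h => MAJ_notMem_AC0 (h ⟨_, signAverage_recognizes saturatedAttention hs fun n j =>
      saturatedAttention_const n 0 j⟩)⟩
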